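/- For positive integers $n,t$, a universal cycle for the $t$-multisets of $[n]=\{1,\dots,n\}$ is a cyclic sequence of $\binom{n+t-1}{t}$ elements of $[n]$ such that every $t$-multiset of $[n]$ (a multiset of $t$ elements of $[n]$, repetitions allowed) appears exactly once as the multiset of entries of $t$ cyclically consecutive terms of the sequence. Let $n_0(3)=4$, $n_0(4)=5$ and $n_0(6)=11$. Then for every $t\in\{3,4,6\}$ and every integer $n\ge n_0(t)$ with $\gcd(n,t)=1$, there exists a universal cycle for the $t$-multisets of $[n]$. -/

import Mathlib

/-- A universal cycle for the `t`-multisets of an `n`-element set (represented by `Fin n`):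
a cyclic sequence of length `binom (n + t - 1) t`, that is, a sequence indexed by the integers
modulo this number, such that every multiset of `t` elements (with repetition allowed) is the
multiset of entries of exactly one block of `t` cyclically consecutive terms. -/
def IsMcycle (n t : ℕ) (a : ZMod ((n + t - 1).choose t) → Fin n) : Prop :=
  ∀ s : Multiset (Fin n), Multiset.card s = t →
    ∃! i : ZMod ((n + t - 1).choose t),
      (Multiset.range t).map (fun j : ℕ => a (i + (j : ZMod ((n + t - 1).choose t)))) = s

/-- The thresholds `n₀(3) = 4`, `n₀(4) = 5`, `n₀(6) = 11`; only these three values are used. -/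
def nZero : ℕ → ℕ
  | 3 => 4
  | 4 => 5
  | 6 => 11
  | _ => 0

/-!
Place the residues modulo `n` around a circle. A `t`-multiset of residues cuts the circle into `t`
gaps with sum `n`, and leaving out one gap turns it into a word: the first letter after that gap,
then the remaining gaps as successive differences. If the gap left out occurs exactly once, this
word is determined by the multiset. Such a gap always exists when `t ∈ {3, 4, 6}` and
`gcd n t = 1`: if every gap occurred at least twice, then a prime factor of `t` would divide the sum
of the gaps, because the parts of any partition of `3`, `4` or `6` into parts `≥ 2` share a factor
with it.

The chosen words are the edges of a directed graph, from the word without its last letter to the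
word without its first letter, and a universal cycle is an Euler tour of it. Rotating the
differences permutes the words compatibly with overlaps, so the graph is balanced. Replacing a
single difference stays inside a connected component, and with a suitable choice of the gap
(the largest one when some gap is `0`, the smallest one otherwise) every word is connected in this
way to the constant words. The case `n = 4`, `t = 3` escapes the last argument and is settled by an
explicit cycle.
-/

section EulerTour

variable {E V α : Type*}

theorem sameCycle_mul_swap_of_not_sameCycle [Finite E] [DecidableEq E] {σ : Equiv.Perm E}
    {e f x : E} (hef : ¬ σ.SameCycle e f) (hx : σ.SameCycle e x) :
    (σ * Equiv.swap e f).SameCycle f x := by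
  obtain ⟨i, hi, -, rfl⟩ := hx.exists_pow_eq''
  clear hx
  induction i, hi using Nat.le_induction with
  | base => exact ⟨1, by simp⟩
  | succ i _ ih =>
    rw [pow_succ', Equiv.Perm.mul_apply]
    by_cases he : (σ ^ i) e = e
    · rw [he]
      exact ⟨1, by simp⟩
    · have hf : (σ ^ i) e ≠ f := fun h => hef ⟨i, by simpa using h⟩
      simpa [Equiv.swap_apply_of_ne_of_ne he hf] using
        (Equiv.Perm.sameCycle_apply_right (f := σ * Equiv.swap e f)).2 ih

theorem exists_eulerTour [Finite E] (tail head : E → V) (σ₀ : Equiv.Perm E)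
    (hσ₀ : ∀ e, tail (σ₀ e) = head e)
    (hconn : ∀ e f, Relation.EqvGen (fun e f => tail f = head e) e f) :
    ∃ σ : Equiv.Perm E, (∀ e, tail (σ e) = head e) ∧ ∀ e f, σ.SameCycle e f := by
  classical
  cases isEmpty_or_nonempty E with
  | inl _ => exact ⟨σ₀, hσ₀, isEmptyElim⟩
  | inr h =>
  obtain ⟨a⟩ := h
  -- Exchanging the successors of two edges with the same head merges their cycles if they differ,
  -- so a cycle through `a` of maximal size contains all edges.
  obtain ⟨σ, hσ, hmax⟩ := Set.exists_max_image {σ : Equiv.Perm E | ∀ e, tail (σ e) = head e}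
    (fun σ => {x | σ.SameCycle a x}.ncard) (Set.toFinite _) ⟨σ₀, hσ₀⟩
  have mem_of_head_eq {e f : E} (hef : head e = head f) (he : σ.SameCycle a e) :
      σ.SameCycle a f := by
    by_contra hf
    have hswap : ∀ y, tail ((σ * Equiv.swap e f) y) = head y := fun y => by
      rw [Equiv.Perm.mul_apply, hσ, Equiv.swap_apply_def]
      split_ifs <;> simp_all
    have merge {x : E} (hx : σ.SameCycle a x) : (σ * Equiv.swap e f).SameCycle f x :=
      sameCycle_mul_swap_of_not_sameCycle (fun h => hf (he.trans h)) (he.symm.trans hx)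
    refine (hmax _ hswap).not_gt (Set.ncard_lt_ncard (Set.ssubset_iff_exists.2
      ⟨fun x hx => (merge (.refl σ a)).symm.trans (merge hx), f,
        (merge (.refl σ a)).symm, hf⟩) (Set.toFinite _))
  have mem_iff {e f : E} (hef : tail f = head e) : σ.SameCycle a e ↔ σ.SameCycle a f := by
    have hpred : head e = head (σ.symm f) := by rw [← hσ (σ.symm f), Equiv.apply_symm_apply, hef]
    rw [← Equiv.Perm.sameCycle_symm_apply_right (y := f)]
    exact ⟨mem_of_head_eq hpred, mem_of_head_eq hpred.symm⟩
  have sameCycle (e : E) : σ.SameCycle a e := by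
    have : ∀ f, Relation.EqvGen (fun e f => tail f = head e) f e →
        (σ.SameCycle a f ↔ σ.SameCycle a e) := fun f h => by
      induction h with
      | rel _ _ h => exact mem_iff h
      | refl _ => rfl
      | symm _ _ _ ih => exact ih.symm
      | trans _ _ _ _ _ ih₁ ih₂ => exact ih₁.trans ih₂
    exact (this a (hconn a e)).1 (.refl σ a)
  exact ⟨σ, hσ, fun e f => (sameCycle e).symm.trans (sameCycle f)⟩

theorem exists_equiv_zmod_of_sameCycle [Finite E] [Nonempty E] {N : ℕ} (hN : Nat.card E = N)
    {σ : Equiv.Perm E} (hσ : ∀ e f, σ.SameCycle e f) :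
    ∃ φ : ZMod N ≃ E, ∀ i, φ (i + 1) = σ (φ i) := by
  classical
  have := Fintype.ofFinite E
  obtain ⟨a⟩ := ‹Nonempty E›
  have hcycle : σ.IsCycleOn (Finset.univ : Finset E) :=
    ⟨by simp, fun e _ f _ => hσ e f⟩
  have zpow_eq_iff (k l : ℤ) : (σ ^ k) a = (σ ^ l) a ↔ (k : ZMod N) = l := by
    rw [hcycle.zpow_apply_eq_zpow_apply (Finset.mem_univ a), ZMod.intCast_eq_intCast_iff,
      Finset.card_univ, ← Nat.card_eq_fintype_card, hN]
  let φ : ZMod N → E := fun i => (σ ^ (i.cast : ℤ)) a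
  have φ_intCast (k : ℤ) : φ k = (σ ^ k) a := (zpow_eq_iff _ _).2 (by simp)
  have hφ : φ.Bijective := by
    refine ⟨fun i j hij => by simpa using (zpow_eq_iff _ _).1 hij, fun e => ?_⟩
    obtain ⟨k, rfl⟩ := hσ a e
    exact ⟨k, φ_intCast k⟩
  refine ⟨Equiv.ofBijective φ hφ, fun i => ?_⟩
  obtain ⟨k, rfl⟩ := ZMod.intCast_surjective i
  change φ (k + 1) = σ (φ k)
  rw [← Int.cast_one, ← Int.cast_add, φ_intCast, φ_intCast, add_comm, zpow_add, zpow_one,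
    Equiv.Perm.mul_apply]

/-- The word `v` can follow the word `u` in a sequence: `v` without its last letter is `u` without
its first letter. -/
def Overlaps (u v : List α) : Prop := v.dropLast = u.tail

theorem map_range_eq_of_overlaps {N t : ℕ} {a : ZMod N → α} {w : ZMod N → List α}
    (hlen : ∀ i, (w i).length = t) (hhead : ∀ i, (w i).head? = some (a i))
    (hw : ∀ i, Overlaps (w i) (w (i + 1))) (i : ZMod N) :
    (List.range t).map (fun j : ℕ => a (i + j)) = w i := by
  have getElem?_eq (j : ℕ) : ∀ i, j < t → (w i)[j]? = some (a (i + j)) := by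
    induction j with
    | zero => simp [← List.head?_eq_getElem?, hhead]
    | succ j ih =>
      intro i hj
      calc (w i)[j + 1]? = (w i).tail[j]? := List.getElem?_tail.symm
        _ = (w (i + 1)).dropLast[j]? := by rw [(hw i : _ = _)]
        _ = (w (i + 1))[j]? := by rw [List.getElem?_dropLast, if_pos (by rw [hlen]; lia)]
        _ = some (a (i + (j + 1 : ℕ))) := by
          rw [ih _ (by lia), Nat.cast_succ, add_assoc, add_comm 1 (j : ZMod N)]
  refine List.ext_getElem? fun j => ?_
  by_cases hj : j < t
  · rw [getElem?_eq j i hj, List.getElem?_map, List.getElem?_range hj, Option.map_some]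
  · rw [List.getElem?_eq_none (by simpa using hj), List.getElem?_eq_none (by rw [hlen]; lia)]

theorem exists_isMcycle_of_eqvGen_overlaps {n t : ℕ} [Nonempty E] (ψ : α ≃ Fin n)
    {word : E → List α} {first : E → α} (hlen : ∀ e, (word e).length = t)
    (hfirst : ∀ e, (word e).head? = some (first e))
    (hword : Function.Bijective fun e => Sym.mk (word e : Multiset α) (hlen e))
    {succ : E → E} (hsucc : succ.Injective) (hoverlaps : ∀ e, Overlaps (word e) (word (succ e)))
    (hconn : ∀ e f, Relation.EqvGen (fun e f => Overlaps (word e) (word f)) e f) :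
    ∃ a : ZMod ((n + t - 1).choose t) → Fin n, IsMcycle n t a := by
  classical
  have : Fintype α := Fintype.ofEquiv _ ψ.symm
  have : Finite E := Finite.of_injective _ hword.injective
  have card_E : Nat.card E = (n + t - 1).choose t := by
    rw [Nat.card_eq_of_bijective _ hword, Nat.card_eq_fintype_card, Sym.card_sym_eq_choose,
      Fintype.card_congr ψ, Fintype.card_fin]
  obtain ⟨σ, hσ, hcycle⟩ := exists_eulerTour (fun e => (word e).dropLast) (fun e => (word e).tail)
    (.ofBijective succ (Finite.injective_iff_bijective.1 hsucc)) hoverlaps hconn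
  obtain ⟨φ, hφ⟩ := exists_equiv_zmod_of_sameCycle card_E hcycle
  refine ⟨fun i => ψ (first (φ i)), fun s hs => ?_⟩
  have map_first (i : ZMod ((n + t - 1).choose t)) :
      (Multiset.range t).map (fun j : ℕ => ψ (first (φ (i + j)))) =
        (word (φ i) : Multiset α).map ψ := by
    rw [← map_range_eq_of_overlaps (w := fun i => word (φ i)) (fun i => hlen (φ i))
      (fun i => hfirst (φ i)) (fun i => by rw [hφ]; exact hσ (φ i)) i, ← Multiset.coe_range]
    simp [Function.comp_def]
  obtain ⟨e, he, he_unique⟩ := hword.existsUnique (Sym.mk (s.map ψ.symm) (by simpa using hs))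
  have word_eq : (word e : Multiset α) = s.map ψ.symm := congrArg Subtype.val he
  refine ⟨φ.symm e, ?_, fun i hi => ?_⟩
  · change Multiset.map _ _ = s
    rw [map_first, Equiv.apply_symm_apply, word_eq]
    simp
  · rw [← he_unique (φ i), Equiv.symm_apply_apply]
    apply Subtype.ext
    change (word (φ i) : Multiset α) = s.map ψ.symm
    rw [← hi, map_first]
    simp

end EulerTour

section Window

variable {R : Type*} [AddMonoidWithOne R] {n k : ℕ}

/-- The word that starts at the letter `x` and whose successive differences are the entries of
`l`; it has one letter more than `l`. -/
def window (x : R) (l : List ℕ) : List R := l.scanl (fun y (d : ℕ) => y + d) x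

@[simp]
theorem length_window (x : R) (l : List ℕ) : (window x l).length = l.length + 1 :=
  List.length_scanl

@[simp]
theorem head?_window (x : R) (l : List ℕ) : (window x l).head? = some x :=
  List.head?_scanl

theorem window_cons (x : R) (d : ℕ) (l : List ℕ) : window x (d :: l) = x :: window (x + d) l :=
  List.scanl_cons

theorem window_append_cons (x : R) (A : List ℕ) (c : ℕ) (B : List ℕ) :
    window x (A ++ c :: B) = window x A ++ window (x + (A.sum : ℕ) + c) B := by
  induction A generalizing x with
  | nil => simp [window]
  | cons d A ih => simp [window_cons, ih, add_assoc]

theorem map_natCast_window (a : ℕ) (l : List ℕ) :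
    (window a l).map (Nat.cast : ℕ → R) = window (a : R) l := by
  induction l generalizing a with
  | nil => simp [window]
  | cons d l ih => simp [window_cons, ih]

theorem add_sum_mem_window (a : ℕ) (l : List ℕ) : a + l.sum ∈ window a l := by
  induction l generalizing a with
  | nil => simp [window]
  | cons d l ih => simpa [window_cons, ← add_assoc] using .inr (ih (a + d))

theorem exists_window_eq_of_pairwise_le {a : ℕ} {ys : List ℕ} (h : (a :: ys).Pairwise (· ≤ ·)) :
    ∃ l, window a l = a :: ys := by
  induction ys generalizing a with
  | nil => exact ⟨[], rfl⟩
  | cons b ys ih =>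
    obtain ⟨l, hl⟩ := ih h.of_cons
    exact ⟨(b - a) :: l, by
      simp [window_cons, Nat.add_sub_cancel' (List.rel_of_pairwise_cons h List.mem_cons_self), hl]⟩

theorem exists_window_eq [NeZero n] (s : Multiset (ZMod n)) (hs : Multiset.card s = k + 1) :
    ∃ (x : ZMod n) (l : List ℕ), l.length = k ∧ l.sum ≤ n ∧
      (window x l : Multiset (ZMod n)) = s := by
  have sort_eq : ((s.map ZMod.val).sort (· ≤ ·) : Multiset ℕ) = s.map ZMod.val :=
    Multiset.sort_eq _ _
  have sorted := Multiset.pairwise_sort (s.map ZMod.val) (· ≤ ·)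
  generalize (s.map ZMod.val).sort (· ≤ ·) = ys at sort_eq sorted
  have length_ys : ys.length = k + 1 := by simpa [hs] using congrArg Multiset.card sort_eq
  obtain ⟨a, ys, rfl⟩ := List.exists_cons_of_length_eq_add_one length_ys
  obtain ⟨l, hl⟩ := exists_window_eq_of_pairwise_le sorted
  have last_lt : a + l.sum < n := by
    have last_mem : a + l.sum ∈ s.map ZMod.val := by
      rw [← sort_eq, ← hl]
      exact add_sum_mem_window a l
    obtain ⟨z, -, hz⟩ := Multiset.mem_map.1 last_mem
    exact hz ▸ z.val_lt
  refine ⟨a, l, by simpa [← hl] using length_ys, by lia, ?_⟩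
  rw [← map_natCast_window, hl, ← Multiset.map_coe, sort_eq, Multiset.map_map]
  simp

end Window

section Selection

variable {n k : ℕ} {ρ : Multiset ℕ → ℕ}

/-- The gaps of the cyclic arrangement with successive differences `M` on a circle of length `n`:
the entries of `M` and the gap `n - M.sum` that closes the circle. The subtraction is only
meaningful when `M.sum ≤ n`. -/
def gaps (n : ℕ) (M : Multiset ℕ) : Multiset ℕ := (n - M.sum) ::ₘ M

theorem card_gaps (n : ℕ) (M : Multiset ℕ) : Multiset.card (gaps n M) = Multiset.card M + 1 :=
  Multiset.card_cons _ _

theorem sum_gaps {M : Multiset ℕ} (hM : M.sum ≤ n) : (gaps n M).sum = n := by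
  rw [gaps, Multiset.sum_cons, Nat.sub_add_cancel hM]

theorem exists_window_eq_of_mem_gaps {c : ℕ} {l : List ℕ} (hl : l.sum ≤ n) (x : ZMod n)
    (hc : c ∈ gaps n l) :
    ∃ (y : ZMod n) (l' : List ℕ), c + l'.sum = n ∧ c ::ₘ (l' : Multiset ℕ) = gaps n l ∧
      (window y l' : Multiset (ZMod n)) = window x l := by
  obtain rfl | hc := Multiset.mem_cons.1 hc
  · exact ⟨x, l, by simpa using Nat.sub_add_cancel hl, rfl, rfl⟩
  obtain ⟨A, B, rfl⟩ := List.append_of_mem (Multiset.mem_coe.1 hc)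
  obtain ⟨r, hr⟩ := Nat.exists_eq_add_of_le' hl
  have gap_eq : n - (A ++ c :: B).sum = r := by lia
  have sum_eq : r + (A.sum + (c + B.sum)) = n := by simpa using hr.symm
  refine ⟨x + (A.sum : ℕ) + c, B ++ r :: A, by simp; lia, ?_, ?_⟩
  · rw [gaps, Multiset.sum_coe, gap_eq, Multiset.cons_coe, Multiset.cons_coe, Multiset.coe_eq_coe]
    grind
  · have turn : x + (A.sum : ℕ) + c + (B.sum : ℕ) + r = x := by
      have := congrArg (Nat.cast : ℕ → ZMod n) sum_eq
      rw [ZMod.natCast_self] at this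
      simp only [Nat.cast_add] at this
      linear_combination this
    rw [window_append_cons, window_append_cons, turn, Multiset.coe_eq_coe]
    exact List.perm_append_comm

/-- A rule choosing, from every multiset of `k + 1` gaps around a circle of length `n`, a gap that
occurs exactly once. -/
def IsSelector (n k : ℕ) (ρ : Multiset ℕ → ℕ) : Prop :=
  ∀ D : Multiset ℕ, Multiset.card D = k + 1 → D.sum = n → D.count (ρ D) = 1

/-- The multiset `M` of differences is selected if the rule `ρ` chooses the gap that is left out
of `M`. Each cyclic arrangement is read as a word in exactly one way that has selected
differences. -/
structure Selected (n k : ℕ) (ρ : Multiset ℕ → ℕ) (M : Multiset ℕ) : Prop where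
  card_eq : Multiset.card M = k
  sum_le : M.sum ≤ n
  rule_eq : ρ (gaps n M) = n - M.sum

theorem Selected.gap_notMem {M : Multiset ℕ} (hρ : IsSelector n k ρ) (hM : Selected n k ρ M) :
    n - M.sum ∉ M := by
  have := hρ (gaps n M) (by rw [card_gaps, hM.card_eq]) (sum_gaps hM.sum_le)
  rw [hM.rule_eq, gaps, Multiset.count_cons_self] at this
  exact Multiset.count_eq_zero.1 (by lia)

theorem exists_selected_window_eq [NeZero n] (hρ : IsSelector n k ρ) (s : Multiset (ZMod n))
    (hs : Multiset.card s = k + 1) :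
    ∃ (x : ZMod n) (l : List ℕ), Selected n k ρ l ∧ (window x l : Multiset (ZMod n)) = s := by
  obtain ⟨x, l, hlen, hsum, rfl⟩ := exists_window_eq s hs
  have count_eq := hρ (gaps n l) (by simp [card_gaps, hlen]) (sum_gaps (by simpa using hsum))
  obtain ⟨y, l', hc, hgaps, hwindow⟩ := exists_window_eq_of_mem_gaps hsum x
    (Multiset.count_pos.1 (by lia : 0 < (gaps n l).count (ρ (gaps n l))))
  have gap_eq : n - (l' : Multiset ℕ).sum = ρ (gaps n l) := by
    rw [Multiset.sum_coe]
    lia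
  refine ⟨y, l', ⟨?_, by rw [Multiset.sum_coe]; lia, ?_⟩, hwindow⟩
  · simpa [card_gaps, hlen] using congrArg Multiset.card hgaps
  · rw [gap_eq, gaps, gap_eq, hgaps]

theorem eq_zero_of_cons_eq_rotate_cons {α : Type*} {r : α} {l l' : List α} {m : ℕ} (hr : r ∉ l')
    (hm : m ≤ l'.length) (h : r :: l = (r :: l').rotate m) : m = 0 := by
  cases m with
  | zero => rfl
  | succ m =>
    have := congrArg List.head? h
    rw [List.head?_rotate (by simpa using hm), List.head?_cons, List.getElem?_cons_succ] at this
    exact absurd (List.mem_of_getElem? this.symm) hr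

/-- The gaps around the circle, read from any of the `k + 1` starting points. -/
def rotateGaps (n k : ℕ) (ρ : Multiset ℕ → ℕ)
    (p : {l : List ℕ // Selected n k ρ l} × Fin (k + 1)) :
    {v : List.Vector ℕ (k + 1) // v.toList.sum = n} :=
  ⟨⟨((n - p.1.1.sum) :: p.1.1).rotate p.2, by simpa using p.1.2.card_eq⟩,
    (List.rotate_perm _ _).sum_eq.trans (sum_gaps p.1.2.sum_le)⟩

theorem rotateGaps_injective (hρ : IsSelector n k ρ) : (rotateGaps n k ρ).Injective := by
  have key (l l' : {l : List ℕ // Selected n k ρ l}) (i j : Fin (k + 1)) (hij : i ≤ j)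
      (h : ((n - l.1.sum) :: l.1).rotate i = ((n - l'.1.sum) :: l'.1).rotate j) :
      l = l' ∧ i = j := by
    obtain ⟨m, hm⟩ := Nat.exists_eq_add_of_le' (Fin.le_def.1 hij)
    rw [hm, ← List.rotate_rotate] at h
    replace h := List.rotate_injective _ h
    have gaps_eq : gaps n l.1 = gaps n l'.1 :=
      Multiset.coe_eq_coe.2 (h ▸ List.rotate_perm _ _)
    have gap_eq : n - l.1.sum = n - l'.1.sum :=
      l.2.rule_eq.symm.trans ((congrArg ρ gaps_eq).trans l'.2.rule_eq)
    have length_eq : l'.1.length = k := l'.2.card_eq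
    rw [gap_eq] at h
    obtain rfl := eq_zero_of_cons_eq_rotate_cons (l'.2.gap_notMem hρ) (by lia) h
    exact ⟨Subtype.ext (by simpa using h), Fin.ext (by lia)⟩
  rintro ⟨l, i⟩ ⟨l', j⟩ h
  replace h := congrArg List.Vector.toList (congrArg Subtype.val h)
  rcases le_total i j with hij | hij
  · obtain ⟨rfl, rfl⟩ := key l l' i j hij h
    rfl
  · obtain ⟨rfl, rfl⟩ := key l' l j i hij h.symm
    rfl

/-- Vectors of `m` natural numbers with sum `n`, as multisets of `n` elements of `Fin m`. -/
noncomputable def vectorSumEquivSym (m n : ℕ) :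
    {v : List.Vector ℕ m // v.toList.sum = n} ≃ Sym (Fin m) n :=
  ((Equiv.vectorEquivFin ℕ m).subtypeEquiv fun v => by
    rw [← List.sum_ofFn, ← List.Vector.toList_ofFn]
    exact iff_of_eq (congrArg (fun w => w.toList.sum = n) v.ofFn_get.symm)).trans
    (Sym.equivNatSumOfFintype (Fin m) n).symm

theorem finite_selected (hρ : IsSelector n k ρ) : Finite {l : List ℕ // Selected n k ρ l} := by
  have : Finite {v : List.Vector ℕ (k + 1) // v.toList.sum = n} :=
    .of_equiv _ (vectorSumEquivSym (k + 1) n).symm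
  exact .of_injective (fun l => rotateGaps n k ρ (l, 0))
    fun _ _ h => (Prod.ext_iff.1 (rotateGaps_injective hρ h)).1

theorem mul_card_selected_le (hρ : IsSelector n k ρ) :
    n * Nat.card {l : List ℕ // Selected n k ρ l} ≤ (n + k).choose (k + 1) := by
  have : Finite {v : List.Vector ℕ (k + 1) // v.toList.sum = n} :=
    .of_equiv _ (vectorSumEquivSym (k + 1) n).symm
  have card_le := Nat.card_le_card_of_injective _ (rotateGaps_injective hρ)
  rw [Nat.card_congr (vectorSumEquivSym (k + 1) n), Nat.card_prod, Nat.card_fin,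
    Nat.card_eq_fintype_card (α := Sym _ _), Sym.card_sym_eq_choose, Fintype.card_fin,
    add_right_comm, Nat.add_sub_cancel, ← Nat.choose_symm_add] at card_le
  refine Nat.le_of_mul_le_mul_right ?_ k.succ_pos
  calc n * Nat.card {l : List ℕ // Selected n k ρ l} * (k + 1)
      ≤ n * (k + n).choose k := by rw [mul_assoc]; exact Nat.mul_le_mul_left n card_le
    _ = (n + k).choose (k + 1) * (k + 1) := by
      rw [Nat.choose_succ_right_eq, Nat.add_sub_cancel, add_comm, mul_comm]

/-- The words of length `k + 1` over the integers modulo `n` whose differences are selected by `ρ`,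
given by their first letter and their differences. -/
abbrev Block (n k : ℕ) (ρ : Multiset ℕ → ℕ) : Type :=
  ZMod n × {l : List ℕ // Selected n k ρ l}

namespace Block

/-- The word encoded by a block. -/
def word (e : Block n k ρ) : List (ZMod n) := window e.1 e.2.1

theorem length_word (e : Block n k ρ) : e.word.length = k + 1 := by
  simpa [word] using e.2.2.card_eq

theorem word_bijective [NeZero n] (hρ : IsSelector n k ρ) :
    Function.Bijective fun e : Block n k ρ =>
      Sym.mk (e.word : Multiset (ZMod n)) e.length_word := by
  have := finite_selected hρ
  refine Function.Surjective.bijective_of_nat_card_le (fun s => ?_) ?_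
  · obtain ⟨x, l, hl, h⟩ := exists_selected_window_eq hρ s.1 s.2
    exact ⟨(x, ⟨l, hl⟩), Subtype.ext h⟩
  · rw [Nat.card_prod, Nat.card_zmod, Nat.card_eq_fintype_card (α := Sym _ _),
      Sym.card_sym_eq_choose, ZMod.card]
    exact mul_card_selected_le hρ

end Block

end Selection

section Connectivity

theorem overlaps_window {R : Type*} [AddMonoidWithOne R] (x : R) (d : ℕ) (m : List ℕ) (c : ℕ) :
    Overlaps (window x (d :: m)) (window (x + d) (m ++ [c])) := by
  rw [Overlaps, window_append_cons, window_cons, List.tail_cons, window, window, List.scanl_nil,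
    List.dropLast_concat]

variable {n k : ℕ} {ρ : Multiset ℕ → ℕ}

namespace Block

/-- The block whose differences are those of `e` rotated by one place, which can follow `e`. -/
def next (e : Block n k ρ) : Block n k ρ :=
  (e.1 + (e.2.1.headD 0 : ℕ), ⟨e.2.1.rotate 1, by
    rw [Multiset.coe_eq_coe.2 (List.rotate_perm e.2.1 1)]
    exact e.2.2⟩)

theorem next_injective : Function.Injective (next : Block n k ρ → Block n k ρ) := by
  rintro ⟨x, l, hl⟩ ⟨y, m, hm⟩ h
  obtain ⟨hx, hlm⟩ := Prod.ext_iff.1 h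
  obtain rfl : l = m := List.rotate_injective 1 (congrArg Subtype.val hlm)
  exact Prod.ext (add_right_cancel hx) rfl

theorem overlaps_next (e : Block n k ρ) : Overlaps e.word e.next.word := by
  rcases e with ⟨x, _ | ⟨d, m⟩, hl⟩
  · rfl
  · simpa [word, next] using overlaps_window x d m d

/-- The equivalence relation on blocks generated by the moves from one block to a block that can
follow it. -/
def Linked (e f : Block n k ρ) : Prop :=
  Relation.EqvGen (fun e f : Block n k ρ => Overlaps e.word f.word) e f

theorem Linked.refl (e : Block n k ρ) : e.Linked e :=
  Relation.EqvGen.refl e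

theorem Linked.symm {e f : Block n k ρ} (h : e.Linked f) : f.Linked e :=
  Relation.EqvGen.symm _ _ h

theorem Linked.trans {e f g : Block n k ρ} (h : e.Linked f) (h' : f.Linked g) : e.Linked g :=
  Relation.EqvGen.trans _ _ _ h h'

theorem linked_cons_concat (x : ZMod n) {d c : ℕ} {m : List ℕ}
    (h : Selected n k ρ (d :: m : List ℕ)) (h' : Selected n k ρ (m ++ [c] : List ℕ)) :
    Linked (x, ⟨d :: m, h⟩) (x + d, ⟨m ++ [c], h'⟩) :=
  .rel _ _ (overlaps_window x d m c)

theorem linked_append_comm (x : ZMod n) {A B : List ℕ} (h : Selected n k ρ (A ++ B : List ℕ))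
    (h' : Selected n k ρ (B ++ A : List ℕ)) :
    Linked (x, ⟨A ++ B, h⟩) (x + (A.sum : ℕ), ⟨B ++ A, h'⟩) := by
  induction A generalizing x B with
  | nil => simpa using Linked.refl _
  | cons d A ih =>
    have hmid : Selected n k ρ (A ++ B ++ [d]) := by
      rwa [Multiset.coe_eq_coe.2 (List.perm_append_singleton _ _)]
    refine (linked_cons_concat x h hmid).trans ?_
    simpa [add_assoc] using ih (x + d) (B := B ++ [d]) (by simpa using hmid) (by simpa using h')

theorem linked_concat_concat (x : ZMod n) {m : List ℕ} {c c' : ℕ}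
    (h : Selected n k ρ (m ++ [c] : List ℕ)) (h' : Selected n k ρ (m ++ [c'] : List ℕ)) :
    Linked (x, ⟨m ++ [c], h⟩) (x, ⟨m ++ [c'], h'⟩) := by
  have hcons : Selected n k ρ (c :: m : List ℕ) := by
    rwa [← Multiset.coe_eq_coe.2 (List.perm_append_singleton _ _)]
  simpa using (linked_cons_concat (x - (c : ZMod n)) hcons h).symm.trans
    (linked_cons_concat (x - (c : ZMod n)) hcons h')

theorem exists_linked_replace (x : ZMod n) {A B : List ℕ} {c c' : ℕ}
    (h : Selected n k ρ (A ++ c :: B : List ℕ)) (h' : Selected n k ρ (A ++ c' :: B : List ℕ)) :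
    ∃ y, Linked (x, ⟨A ++ c :: B, h⟩) (y, ⟨A ++ c' :: B, h'⟩) := by
  have rotated {c : ℕ} (h : Selected n k ρ (A ++ c :: B)) :
      Selected n k ρ (B ++ (A ++ [c])) := by
    rwa [Multiset.coe_eq_coe.2 (by grind : (B ++ (A ++ [c])).Perm (A ++ c :: B))]
  have rotate {c : ℕ} (h : Selected n k ρ (A ++ c :: B)) (x : ZMod n) :
      Linked (x, ⟨A ++ c :: B, h⟩)
        (x + ((A ++ [c]).sum : ℕ), ⟨B ++ (A ++ [c]), rotated h⟩) := by
    simpa using linked_append_comm x (A := A ++ [c]) (by simpa using h) (rotated h)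
  have replace_last (z : ZMod n) :
      Linked (z, ⟨B ++ (A ++ [c]), rotated h⟩) (z, ⟨B ++ (A ++ [c']), rotated h'⟩) := by
    simpa using linked_concat_concat z (m := B ++ A) (by simpa using rotated h)
      (by simpa using rotated h')
  have rotate_back (z : ZMod n) :
      Linked (z, ⟨B ++ (A ++ [c']), rotated h'⟩)
        (z - ((A ++ [c']).sum : ℕ), ⟨A ++ c' :: B, h'⟩) := by
    simpa only [sub_add_cancel] using (rotate h' (z - ((A ++ [c']).sum : ℕ))).symm
  exact ⟨_, (rotate h x).trans ((replace_last _).trans (rotate_back _))⟩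

end Block

/-- `M'` arises from `M` by replacing one element, both multisets of differences being selected. -/
def SelectedStep (n k : ℕ) (ρ : Multiset ℕ → ℕ) (M M' : Multiset ℕ) : Prop :=
  Selected n k ρ M ∧ Selected n k ρ M' ∧ ∃ N c d, M = c ::ₘ N ∧ M' = d ::ₘ N

/-- The multiset `M` of differences can be turned into the one of a constant word by replacing one
element at a time, through selected multisets only. -/
def ReducesToZero (n k : ℕ) (ρ : Multiset ℕ → ℕ) (M : Multiset ℕ) : Prop :=
  Relation.ReflTransGen (SelectedStep n k ρ) M (Multiset.replicate k 0)

namespace Block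

theorem exists_linked_replicate_zero (hzero : Selected n k ρ (List.replicate k 0))
    {l : List ℕ} (hl : Selected n k ρ l) (hred : ReducesToZero n k ρ l) (x : ZMod n) :
    ∃ y, Linked (x, ⟨l, hl⟩) (y, ⟨List.replicate k 0, hzero⟩) := by
  unfold ReducesToZero at hred
  generalize hM : (l : Multiset ℕ) = M at hred
  induction hred using Relation.ReflTransGen.head_induction_on generalizing l x with
  | refl =>
    obtain rfl : l = List.replicate k 0 := by
      rwa [← Multiset.coe_replicate, Multiset.coe_eq_coe, List.perm_replicate] at hM
    exact ⟨x, .refl _⟩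
  | head hstep _ ih =>
    obtain ⟨-, hM', N, c, c', rfl, rfl⟩ := hstep
    obtain ⟨A, B, rfl⟩ := List.append_of_mem (Multiset.mem_coe.1 (hM ▸ Multiset.mem_cons_self c N))
    have hl' : ((A ++ c' :: B : List ℕ) : Multiset ℕ) = c' ::ₘ N := by
      rw [Multiset.coe_eq_coe.2 List.perm_middle, ← Multiset.cons_coe,
        Multiset.cons_inj_right] at hM ⊢
      exact hM
    obtain ⟨y, hy⟩ := exists_linked_replace x hl (hl'.symm ▸ hM')
    obtain ⟨z, hz⟩ := ih (hl'.symm ▸ hM') y hl'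
    exact ⟨z, hy.trans hz⟩

theorem linked_replicate_zero_add_one (hone : Selected n (k + 1) ρ (1 ::ₘ .replicate k 0))
    (hzero : Selected n (k + 1) ρ (List.replicate (k + 1) 0)) (x : ZMod n) :
    Linked (x, ⟨List.replicate (k + 1) 0, hzero⟩) (x + 1, ⟨List.replicate (k + 1) 0, hzero⟩) := by
  have hzero' : Selected n (k + 1) ρ (List.replicate k 0 ++ [0] : List ℕ) := by
    rwa [← List.replicate_succ']
  have hone' : Selected n (k + 1) ρ (List.replicate k 0 ++ [1] : List ℕ) := by
    rwa [Multiset.coe_eq_coe.2 (List.perm_append_singleton _ _)]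
  have lift_last := linked_concat_concat x hzero' hone'
  have rotate := linked_append_comm x hone' hone
  have drop_last := linked_cons_concat x hone hzero'
  simp only [List.sum_replicate, smul_zero, Nat.cast_zero, add_zero] at rotate
  have := lift_last.trans (rotate.trans drop_last)
  simpa [List.replicate_succ'] using this

theorem linked_replicate_zero [NeZero n] (hone : Selected n (k + 1) ρ (1 ::ₘ .replicate k 0))
    (hzero : Selected n (k + 1) ρ (List.replicate (k + 1) 0)) (x y : ZMod n) :
    Linked (x, ⟨List.replicate (k + 1) 0, hzero⟩) (y, ⟨List.replicate (k + 1) 0, hzero⟩) := by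
  have linked_add (j : ℕ) :
      Linked (x, ⟨List.replicate (k + 1) 0, hzero⟩)
        (x + j, ⟨List.replicate (k + 1) 0, hzero⟩) := by
    induction j with
    | zero => simpa using Linked.refl _
    | succ j ih => simpa [add_assoc] using ih.trans (linked_replicate_zero_add_one hone hzero _)
  simpa using linked_add (y - x).val

end Block

theorem exists_isMcycle_of_selector [NeZero n] (hρ : IsSelector n (k + 1) ρ)
    (hone : Selected n (k + 1) ρ (1 ::ₘ Multiset.replicate k 0))
    (hred : ∀ M, Selected n (k + 1) ρ M → ReducesToZero n (k + 1) ρ M)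
    (hzero : Selected n (k + 1) ρ (Multiset.replicate (k + 1) 0)) :
    ∃ a : ZMod ((n + (k + 2) - 1).choose (k + 2)) → Fin n, IsMcycle n (k + 2) a := by
  have : Nonempty (Block n (k + 1) ρ) := ⟨0, List.replicate (k + 1) 0, hzero⟩
  refine exists_isMcycle_of_eqvGen_overlaps (ZMod.finEquiv n).symm.toEquiv
    Block.length_word (fun e => head?_window e.1 e.2.1) (Block.word_bijective hρ)
    Block.next_injective Block.overlaps_next fun ⟨x, l, hl⟩ ⟨y, m, hm⟩ => ?_
  obtain ⟨x', hx⟩ := Block.exists_linked_replicate_zero hzero hl (hred _ hl) x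
  obtain ⟨y', hy⟩ := Block.exists_linked_replicate_zero hzero hm (hred _ hm) y
  exact (hx.trans (Block.linked_replicate_zero hone hzero x' y')).trans hy.symm

end Connectivity

section PickRule

variable {n k : ℕ}

/-- No element of the multiset `D` occurs exactly once. -/
def NoSimple (D : Multiset ℕ) : Prop := ∀ c, D.count c ≠ 1

/-- The gap left out of a block: the largest simple gap if some gap is `0`, and the smallest simple
gap otherwise. If there is no simple gap, the value `0` is junk. -/
noncomputable def pick (D : Multiset ℕ) : ℕ :=
  if 0 ∈ D then sSup {c | D.count c = 1} else sInf {c | D.count c = 1}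

theorem pick_eq_of_isGreatest {D : Multiset ℕ} {c : ℕ} (h₀ : 0 ∈ D)
    (hc : IsGreatest {c | D.count c = 1} c) : pick D = c := by
  rw [pick, if_pos h₀, hc.csSup_eq]

theorem pick_eq_of_isLeast {D : Multiset ℕ} {c : ℕ} (h₀ : 0 ∉ D)
    (hc : IsLeast {c | D.count c = 1} c) : pick D = c := by
  rw [pick, if_neg h₀, hc.csInf_eq]

theorem bddAbove_count_eq_one (D : Multiset ℕ) : BddAbove {c | D.count c = 1} :=
  ⟨D.sum, fun _ hc => Multiset.le_sum_of_mem (Multiset.count_pos.1 (hc ▸ one_pos))⟩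

theorem count_pick {D : Multiset ℕ} (hD : ¬ NoSimple D) : D.count (pick D) = 1 := by
  have hne : {c | D.count c = 1}.Nonempty := not_forall_not.1 hD
  rw [pick]
  split_ifs
  · exact Nat.sSup_mem hne (bddAbove_count_eq_one D)
  · exact Nat.sInf_mem hne

theorem Selected.zero_notMem_of_sum_eq {M : Multiset ℕ} (hρ : IsSelector n k pick)
    (hM : Selected n k pick M) (hsum : M.sum = n) : 0 ∉ M := by
  simpa [hsum] using hM.gap_notMem hρ

theorem Selected.noSimple_of_sum_eq {M : Multiset ℕ} (hρ : IsSelector n k pick)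
    (hM : Selected n k pick M) (hsum : M.sum = n) : NoSimple M := by
  intro c hc
  have c_ne : c ≠ 0 := by
    rintro rfl
    exact hM.zero_notMem_of_sum_eq hρ hsum (Multiset.count_pos.1 (hc ▸ one_pos))
  have pick_eq : sSup {c | (gaps n M).count c = 1} = 0 := by
    have := hM.rule_eq
    rwa [hsum, Nat.sub_self, pick, if_pos (by simp [gaps, hsum])] at this
  have := le_csSup (bddAbove_count_eq_one (gaps n M))
    (show (gaps n M).count c = 1 by simp [gaps, hsum, c_ne, hc])
  lia

theorem selected_of_add_sum_lt {M : Multiset ℕ} (hcard : Multiset.card M = k) (h₀ : 0 ∈ M)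
    (hM : ∀ b ∈ M, b + M.sum < n) : Selected n k pick M := by
  have sum_lt : M.sum < n := by simpa using hM 0 h₀
  refine ⟨hcard, sum_lt.le, pick_eq_of_isGreatest (Multiset.mem_cons_of_mem h₀) ⟨?_, ?_⟩⟩
  · have gap_notMem : n - M.sum ∉ M := fun h => by
      have := hM _ h
      lia
    simp [gaps, Multiset.count_eq_zero.2 gap_notMem]
  · intro c hc
    have c_mem : c ∈ gaps n M := Multiset.count_pos.1 (hc ▸ one_pos)
    obtain rfl | hc := Multiset.mem_cons.1 c_mem
    · rfl
    · have := hM c hc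
      lia

theorem reducesToZero_of_add_sum_lt {M : Multiset ℕ} (hcard : Multiset.card M = k) (h₀ : 0 ∈ M)
    (hM : ∀ b ∈ M, b + M.sum < n) : ReducesToZero n k pick M := by
  induction h : M.sum using Nat.strong_induction_on generalizing M with
  | _ s ih =>
  subst h
  by_cases hzero : ∀ b ∈ M, b = 0
  · rw [Multiset.eq_replicate.2 ⟨hcard, hzero⟩]
    exact .refl
  push Not at hzero
  obtain ⟨b, hb, b_ne⟩ := hzero
  obtain ⟨N, rfl⟩ := Multiset.exists_cons_of_mem hb
  have hN : ∀ c ∈ 0 ::ₘ N, c + (0 ::ₘ N).sum < n := by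
    intro c hc
    simp only [Multiset.mem_cons, Multiset.sum_cons] at hM hc ⊢
    obtain rfl | hc := hc
    · have := hM b (.inl rfl)
      lia
    · have := hM c (.inr hc)
      lia
  have hcard' : Multiset.card (0 ::ₘ N) = k := by simpa using hcard
  exact .head ⟨selected_of_add_sum_lt hcard h₀ hM,
      selected_of_add_sum_lt hcard' (Multiset.mem_cons_self 0 N) hN, N, b, 0, rfl, rfl⟩
    (ih _ (by simpa using Nat.pos_of_ne_zero b_ne) hcard' (Multiset.mem_cons_self 0 N) hN rfl)

theorem Selected.reducesToZero_of_sum_lt {M : Multiset ℕ} (hM : Selected n k pick M)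
    (hsum : M.sum < n) : ReducesToZero n k pick M := by
  by_cases hzero : ∀ b ∈ M, b = 0
  · rw [Multiset.eq_replicate.2 ⟨hM.card_eq, hzero⟩]
    exact .refl
  push Not at hzero
  obtain ⟨b, hb, -⟩ := hzero
  obtain ⟨m, hm, hmax⟩ := M.toFinset.exists_max_image id ⟨b, Multiset.mem_toFinset.2 hb⟩
  obtain ⟨N, rfl⟩ := Multiset.exists_cons_of_mem (Multiset.mem_toFinset.1 hm)
  have hN : ∀ c ∈ 0 ::ₘ N, c + (0 ::ₘ N).sum < n := by
    intro c hc
    simp only [Multiset.mem_toFinset, Multiset.mem_cons, Multiset.sum_cons, id] at hmax hsum hc ⊢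
    obtain rfl | hc := hc
    · lia
    · have := hmax c (.inr hc)
      lia
  have hcard : Multiset.card (0 ::ₘ N) = k := by simpa using hM.card_eq
  exact .head ⟨hM, selected_of_add_sum_lt hcard (Multiset.mem_cons_self 0 N) hN, N, m, 0, rfl, rfl⟩
    (reducesToZero_of_add_sum_lt hcard (Multiset.mem_cons_self 0 N) hN)

theorem Selected.reducesToZero_of_replace {N : Multiset ℕ} {r c c' : ℕ}
    (hM : Selected n k pick (c ::ₘ N)) (hsum : (c ::ₘ N).sum = n) (hr : 0 < r) (hc : r + c' = c)
    (hpick : pick (r ::ₘ c' ::ₘ N) = r) : ReducesToZero n k pick (c ::ₘ N) := by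
  rw [Multiset.sum_cons] at hsum
  have hM' : Selected n k pick (c' ::ₘ N) := by
    have gap_eq : n - (c' ::ₘ N).sum = r := by
      rw [Multiset.sum_cons]
      lia
    refine ⟨by simpa using hM.card_eq, by rw [Multiset.sum_cons]; lia, ?_⟩
    rwa [gaps, gap_eq]
  exact .head ⟨hM, hM', N, c, c', rfl, rfl⟩
    (hM'.reducesToZero_of_sum_lt (by rw [Multiset.sum_cons]; lia))

theorem NoSimple.eq_or_eq_of_card_le {N : Multiset ℕ} {a b c : ℕ} (h : NoSimple (a ::ₘ N))
    (hcard : Multiset.card N ≤ 4) (hab : a ≠ b) (hb : b ∈ N) (hc : c ∈ N) : c = a ∨ c = b := by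
  by_contra! hne
  have five_le : ({a, b, b, c, c} : Multiset ℕ) ≤ N := Multiset.le_iff_count.2 fun d => by
    have count_b := Multiset.count_pos.2 hb
    have count_c := Multiset.count_pos.2 hc
    have count_a := h a
    have b_ne_one := h b
    have c_ne_one := h c
    simp only [Multiset.insert_eq_cons, Multiset.count_cons, Multiset.count_singleton]
      at count_a b_ne_one c_ne_one ⊢
    grind
  simpa using (Multiset.card_le_card five_le).trans hcard

theorem Selected.reducesToZero_of_one_notMem {N : Multiset ℕ} {a : ℕ}
    (hM : Selected n k pick (a ::ₘ N)) (hsum : (a ::ₘ N).sum = n) (ha : 3 ≤ a) (h₀ : 0 ∉ N)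
    (h₁ : 1 ∉ N) : ReducesToZero n k pick (a ::ₘ N) := by
  refine hM.reducesToZero_of_replace (r := 1) (c' := a - 1) hsum (by lia) (by lia)
    (pick_eq_of_isLeast (by grind) ⟨?_, fun d hd => ?_⟩)
  · rw [Set.mem_ofPred_eq, Multiset.count_cons_self, Multiset.count_cons_of_ne (by lia),
      Multiset.count_eq_zero.2 h₁]
  · have d_mem : d ∈ 1 ::ₘ (a - 1) ::ₘ N := Multiset.count_pos.1 (one_pos.trans_eq hd.symm)
    grind

theorem Selected.reducesToZero_of_one_mem {N : Multiset ℕ} {a : ℕ}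
    (hM : Selected n k pick (a ::ₘ N)) (hsum : (a ::ₘ N).sum = n) (ha : 3 ≤ a) (h₀ : 0 ∉ N)
    (h₁ : 1 ∈ N) (hsimple : NoSimple (a ::ₘ N)) (hk : k ≤ 5) :
    ReducesToZero n k pick (a ::ₘ N) := by
  have hcard := hM.card_eq
  rw [Multiset.card_cons] at hcard
  have mem_N {c : ℕ} (hc : c ∈ N) : c = a ∨ c = 1 :=
    hsimple.eq_or_eq_of_card_le (by lia) (by lia) h₁ hc
  have count_one := Multiset.count_pos.2 h₁
  refine hM.reducesToZero_of_replace (r := a - 1) (c' := 1) hsum (by lia) (by lia)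
    (pick_eq_of_isLeast (by grind) ⟨?_, fun d hd => ?_⟩)
  · rw [Set.mem_ofPred_eq, Multiset.count_cons_self, Multiset.count_cons_of_ne (by lia),
      Multiset.count_eq_zero.2 fun h => by grind]
  · have d_mem : d ∈ (a - 1) ::ₘ 1 ::ₘ N := Multiset.count_pos.1 (one_pos.trans_eq hd.symm)
    have d_ne : d ≠ 1 := by
      rintro rfl
      rw [Set.mem_ofPred_eq, Multiset.count_cons_of_ne (by lia), Multiset.count_cons_self] at hd
      lia
    grind

theorem exists_isMcycle_of_not_noSimple (hn : 3 ≤ n) (hk : k + 2 ≤ 5)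
    (hsimple : ∀ D : Multiset ℕ, Multiset.card D = k + 3 → D.sum = n → ¬ NoSimple D)
    (hlarge : ∀ M : Multiset ℕ, Multiset.card M = k + 2 → M.sum = n → NoSimple M →
      ∃ a ∈ M, 3 ≤ a) :
    ∃ a : ZMod ((n + (k + 3) - 1).choose (k + 3)) → Fin n, IsMcycle n (k + 3) a := by
  have : NeZero n := ⟨by lia⟩
  have hρ : IsSelector n (k + 2) pick := fun D hcard hsum => count_pick (hsimple D hcard hsum)
  refine exists_isMcycle_of_selector hρ ?_ (fun M hM => ?_) ?_
  · exact selected_of_add_sum_lt (by simp) (by simp) fun b hb => by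
      simp only [Multiset.sum_cons, Multiset.sum_replicate, smul_zero]
      grind [Multiset.mem_replicate]
  · obtain hlt | heq := hM.sum_le.lt_or_eq
    · exact hM.reducesToZero_of_sum_lt hlt
    · obtain ⟨a, ha, h3⟩ := hlarge M hM.card_eq heq (hM.noSimple_of_sum_eq hρ heq)
      have h₀ := hM.zero_notMem_of_sum_eq hρ heq
      obtain ⟨N, rfl⟩ := Multiset.exists_cons_of_mem ha
      rw [Multiset.mem_cons, not_or] at h₀
      by_cases h₁ : 1 ∈ N
      · exact hM.reducesToZero_of_one_mem heq h3 h₀.2 h₁ (hM.noSimple_of_sum_eq hρ heq) hk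
      · exact hM.reducesToZero_of_one_notMem heq h3 h₀.2 h₁
  · exact selected_of_add_sum_lt (by simp) (by simp) fun b hb => by
      rw [Multiset.eq_of_mem_replicate hb, Multiset.sum_replicate, smul_zero]
      lia

end PickRule

section SumDivisibility

variable {D : Multiset ℕ}

theorem NoSimple.exists_eq_replicate_add {a : ℕ} (hD : NoSimple D) (ha : a ∈ D) :
    ∃ j D', 2 ≤ j ∧ D = Multiset.replicate j a + D' ∧ NoSimple D' := by
  have count_pos := Multiset.count_pos.2 ha
  have count_ne_one := hD a
  refine ⟨D.count a, D.filter (a ≠ ·), by lia, ?_, fun c => ?_⟩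
  · rw [← Multiset.filter_eq, Multiset.filter_add_not]
  · rw [Multiset.count_filter]
    split_ifs
    exacts [hD c, zero_ne_one]

theorem NoSimple.card_ne_one (hD : NoSimple D) : Multiset.card D ≠ 1 := fun h => by
  obtain ⟨c, rfl⟩ := Multiset.card_eq_one.1 h
  exact hD c (Multiset.count_singleton_self c)

theorem NoSimple.eq_replicate {a : ℕ} (hD : NoSimple D) (hcard : Multiset.card D ≤ 3)
    (ha : a ∈ D) : D = Multiset.replicate (Multiset.card D) a := by
  obtain ⟨j, D', hj, rfl, hD'⟩ := hD.exists_eq_replicate_add ha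
  rw [Multiset.card_add, Multiset.card_replicate] at hcard
  have card_ne := hD'.card_ne_one
  obtain rfl := Multiset.card_eq_zero.1 (by lia : Multiset.card D' = 0)
  simp

theorem NoSimple.card_dvd_sum (hD : NoSimple D) (hcard : Multiset.card D ≤ 3) :
    Multiset.card D ∣ D.sum := by
  obtain rfl | ⟨a, ha⟩ := D.empty_or_exists_mem
  · simp
  · rw [hD.eq_replicate hcard ha]
    simp

theorem NoSimple.two_dvd_sum_of_card_eq_four (hD : NoSimple D) (hcard : Multiset.card D = 4) :
    2 ∣ D.sum := by
  obtain ⟨a, ha⟩ := Multiset.card_pos_iff_exists_mem.1 (by lia : 0 < Multiset.card D)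
  obtain ⟨j, D', hj, rfl, hD'⟩ := hD.exists_eq_replicate_add ha
  rw [Multiset.card_add, Multiset.card_replicate] at hcard
  rw [Multiset.sum_add, Multiset.sum_replicate, smul_eq_mul]
  have card_ne := hD'.card_ne_one
  have dvd := hD'.card_dvd_sum (by lia)
  obtain ⟨rfl, h⟩ | ⟨rfl, h⟩ : (j = 2 ∧ Multiset.card D' = 2) ∨
    (j = 4 ∧ Multiset.card D' = 0) := by lia
  all_goals rw [h] at dvd; lia

theorem NoSimple.two_or_three_dvd_sum_of_card_eq_six (hD : NoSimple D)
    (hcard : Multiset.card D = 6) : 2 ∣ D.sum ∨ 3 ∣ D.sum := by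
  obtain ⟨a, ha⟩ := Multiset.card_pos_iff_exists_mem.1 (by lia : 0 < Multiset.card D)
  obtain ⟨j, D', hj, rfl, hD'⟩ := hD.exists_eq_replicate_add ha
  rw [Multiset.card_add, Multiset.card_replicate] at hcard
  rw [Multiset.sum_add, Multiset.sum_replicate, smul_eq_mul]
  have card_ne := hD'.card_ne_one
  obtain rfl | hj : j = 2 ∨ 3 ≤ j := by lia
  · have := hD'.two_dvd_sum_of_card_eq_four (by lia)
    lia
  · have dvd := hD'.card_dvd_sum (by lia)
    obtain ⟨rfl, h⟩ | ⟨rfl, h⟩ | ⟨rfl, h⟩ : (j = 3 ∧ Multiset.card D' = 3) ∨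
      (j = 4 ∧ Multiset.card D' = 2) ∨ (j = 6 ∧ Multiset.card D' = 0) := by lia
    all_goals rw [h] at dvd; lia

theorem exists_three_le_of_two_mul_card_lt_sum {M : Multiset ℕ}
    (hM : 2 * Multiset.card M < M.sum) : ∃ a ∈ M, 3 ≤ a := by
  by_contra! hlt
  have := M.sum_le_card_nsmul 2 fun a ha => Nat.le_of_lt_succ (hlt a ha)
  rw [smul_eq_mul] at this
  lia

end SumDivisibility

theorem exists_isMcycle_three {n : ℕ} (hn : 4 < n) (hgcd : Nat.Coprime n 3) :
    ∃ a : ZMod ((n + 3 - 1).choose 3) → Fin n, IsMcycle n 3 a := by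
  refine exists_isMcycle_of_not_noSimple (k := 0) (by lia) (by lia) (fun D hcard hsum hD => ?_)
    fun M hcard hsum _ => exists_three_le_of_two_mul_card_lt_sum (by lia)
  have := hD.card_dvd_sum hcard.le
  rw [hcard, hsum] at this
  exact Nat.not_coprime_of_dvd_of_dvd (by lia) this dvd_rfl hgcd

theorem exists_isMcycle_four {n : ℕ} (hn : 5 ≤ n) (hgcd : Nat.Coprime n 4) :
    ∃ a : ZMod ((n + 4 - 1).choose 4) → Fin n, IsMcycle n 4 a := by
  refine exists_isMcycle_of_not_noSimple (k := 1) (by lia) (by lia) (fun D hcard hsum hD => ?_)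
    fun M hcard hsum hM => ?_
  · exact Nat.not_coprime_of_dvd_of_dvd one_lt_two (hsum ▸ hD.two_dvd_sum_of_card_eq_four hcard)
      (by lia : 2 ∣ 4) hgcd
  · obtain ⟨a, ha⟩ := Multiset.card_pos_iff_exists_mem.1 (by lia : 0 < Multiset.card M)
    refine ⟨a, ha, ?_⟩
    rw [hM.eq_replicate hcard.le ha, hcard, Multiset.sum_replicate, smul_eq_mul] at hsum
    have : ¬ 2 ∣ n := fun h => Nat.not_coprime_of_dvd_of_dvd one_lt_two h (by lia : 2 ∣ 4) hgcd
    lia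

theorem exists_isMcycle_six {n : ℕ} (hn : 11 ≤ n) (hgcd : Nat.Coprime n 6) :
    ∃ a : ZMod ((n + 6 - 1).choose 6) → Fin n, IsMcycle n 6 a := by
  refine exists_isMcycle_of_not_noSimple (k := 3) (by lia) (by lia) (fun D hcard hsum hD => ?_)
    fun M hcard hsum _ => exists_three_le_of_two_mul_card_lt_sum (by lia)
  obtain h | h := hsum ▸ hD.two_or_three_dvd_sum_of_card_eq_six hcard
  · exact Nat.not_coprime_of_dvd_of_dvd (by lia) h (by lia : 2 ∣ 6) hgcd
  · exact Nat.not_coprime_of_dvd_of_dvd (by lia) h (by lia : 3 ∣ 6) hgcd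

/-- A universal cycle for the `3`-multisets of a `4`-element set. -/
def mcycleFourThree : ZMod 20 → Fin 4 :=
  ![0, 0, 0, 1, 1, 1, 2, 0, 2, 0, 3, 1, 3, 1, 2, 2, 2, 3, 3, 3]

set_option maxRecDepth 10000 in
theorem isMcycle_four_three : IsMcycle 4 3 mcycleFourThree := by
  change ∀ s : Multiset (Fin 4), Multiset.card s = 3 → ∃! i : ZMod 20,
    (Multiset.range 3).map (fun j : ℕ => mcycleFourThree (i + (j : ZMod 20) : ZMod 20)) = s
  intro s hs
  obtain ⟨x, y, z, rfl⟩ := Multiset.card_eq_three.1 hs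
  clear hs
  simp only [ExistsUnique]
  revert x y z
  decide

theorem mainTheorem1 (t n : ℕ) (ht : t ∈ ({3, 4, 6} : Set ℕ)) (hn : nZero t ≤ n)
    (hgcd : Nat.Coprime n t) :
    ∃ a : ZMod ((n + t - 1).choose t) → Fin n, IsMcycle n t a := by
  simp only [Set.mem_insert_iff, Set.mem_singleton_iff] at ht
  rcases ht with rfl | rfl | rfl
  · rcases (show 4 ≤ n from hn).eq_or_lt with rfl | h
    · exact ⟨_, isMcycle_four_three⟩
    · exact exists_isMcycle_three h hgcd
  · exact exists_isMcycle_four hn hgcd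
  · exact exists_isMcycle_six hn hgcd
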